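/- **Conventions.** Fix a free ultrafilter $\mathcal U$ on $\mathbb N$. For a unital C*-algebra $A$ let $T(A)$ be its set of tracial states, with the weak* topology, and for $T(A)\neq\emptyset$ put $\|a\|_{2,T(A)}=\sup_{\tau\in T(A)}\tau(a^*a)^{1/2}$. Let $$A^{\mathcal U}=\ell^\infty(A)\big/\big\{(a_n)_n : \lim_{n\to\mathcal U}\|a_n\|_{2,T(A)}=0\big\},$$ and write $a\in A$ also for the class of the constant sequence $a$ in $A^{\mathcal U}$. Let $T_{\mathcal U}(A)$ be the set of limit traces on $A^{\mathcal U}$, i.e. the functionals $[(a_n)_n]\mapsto\lim_{n\to\mathcal U}\tau_n(a_n)$ with $\tau_n\in T(A)$ for all $n$. A unital sub-C*-algebra $(D\subseteq A)$ is a unital C*-algebra $A$ with a C*-subalgebra $D$ containing $1_A$; let $\kappa(D^{\mathcal U})\subseteq A^{\mathcal U}$ be the set of elements represented by bounded sequences in $D$. A unital sub-C*-algebra $(D\subseteq A)$ with $A$ separable and $T(A)$ nonempty (and hence weak* compact) has *uniform property $\Gamma$* if $1_{A^{\mathcal U}}\in\kappa(D^{\mathcal U})$ and for every integer $k\ge 1$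 there are projections $q_1,\dots,q_k\in\kappa(D^{\mathcal U})\cap A'$ with $\sum_{i=1}^k q_i=1_{A^{\mathcal U}}$ and $$\tau(q_i a)=\tfrac1k\,\tau(a)\qquad\text{for all }\tau\in T_{\mathcal U}(A),\ a\in D,\ i=1,\dots,k.$$ **Proposition 5.7.** Let $(D_A\subseteq A)$ and $(D_B\subseteq B)$ be unital sub-C*-algebras such that $A$ and $B$ are separable with $T(A)\ne\emptyset$ and $T(B)\neq\emptyset$. Let $A\otimes B$ be the minimal tensor product and let $D_A\otimes D_B\subseteq A\otimes B$ be the minimal tensor product of $D_A$ and $D_B$, i.e. the C*-subalgebra of $A\otimes B$ generated by the elementary tensors $d\otimes e$ with $d\in D_A$, $e\in D_B$. If $(D_A\subseteq A)$ has uniform property $\Gamma$, then $(D_A\otimes D_B\subseteq A\otimes B)$ has uniform property $\Gamma$ (in particular, $A\otimes B$ is separable with nonempty weak* compact trace space). -/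

import Mathlib

open Filter Topology
open scoped ComplexOrder BoundedContinuousFunction TensorProduct ENNReal

noncomputable section

/-! ## Traces and the uniform 2-seminorm -/

section Traces

variable (A : Type*) [CStarAlgebra A]

/-- The trace space `T(A)` of a unital C⋆-algebra: the set of tracial states on `A`, inside the
dual of `A` with the weak-⋆ topology. -/
def traceSpace : Set (WeakDual ℂ A) :=
  {τ | (∀ a : A, 0 ≤ τ (star a * a)) ∧ τ 1 = 1 ∧ ∀ a b : A, τ (a * b) = τ (b * a)}

variable {A}

/-- The uniform 2-seminorm `‖a‖_{2,T(A)} = sup_{τ ∈ T(A)} τ(a⋆a)^{1/2}`. -/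
def uniformTwoNorm (a : A) : ℝ :=
  ⨆ τ : traceSpace A, Real.sqrt ((τ : WeakDual ℂ A) (star a * a)).re

/-- Auxiliary: the seminorm of a single trace has the basic properties of a tracial 2-norm. -/
lemma traceSpace.sqrt_facts {τ : WeakDual ℂ A} (hτ : τ ∈ traceSpace A) :
    (∀ a b : A, Real.sqrt (τ (star (a + b) * (a + b))).re ≤
      Real.sqrt (τ (star a * a)).re + Real.sqrt (τ (star b * b)).re) ∧
    (∀ a b : A, Real.sqrt (τ (star (a * b) * (a * b))).re ≤
      ‖a‖ * Real.sqrt (τ (star b * b)).re) ∧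
    (∀ a : A, Real.sqrt (τ (star (star a) * star a)).re = Real.sqrt (τ (star a * a)).re) ∧
    (∀ a : A, Real.sqrt (τ (star a * a)).re ≤ ‖a‖) := by
  let _ := CStarAlgebra.spectralOrder A
  have := CStarAlgebra.spectralOrderedRing A
  let f : A →ₚ[ℂ] ℂ := PositiveLinearMap.mk₀
    { toFun := fun a => τ a, map_add' := map_add τ, map_smul' := map_smul τ } (by
      intro x hx
      obtain ⟨y, rfl⟩ := CStarAlgebra.nonneg_iff_eq_star_mul_self.mp hx
      exact hτ.1 y)
  have hn : ∀ a : A, Real.sqrt (τ (star a * a)).re = ‖f.toPreGNS a‖ := fun a => rfl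
  have hmul : ∀ a b : A, Real.sqrt (τ (star (a * b) * (a * b))).re ≤
      ‖a‖ * Real.sqrt (τ (star b * b)).re := by
    intro a b
    rw [hn, hn]
    exact ((f.leftMulMapPreGNS a).le_opNorm (f.toPreGNS b)).trans
      (mul_le_mul_of_nonneg_right
        (LinearMap.mkContinuous_norm_le _ (norm_nonneg a) _) (norm_nonneg _))
  refine ⟨fun a b => ?_, hmul, fun a => ?_, fun a => ?_⟩
  · rw [hn, hn, hn, map_add]
    exact norm_add_le _ _
  · rw [star_star, hτ.2.2]
  · have h := hmul a 1
    simpa [hτ.2.1] using h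

lemma uniformTwoNorm_bddAbove (a : A) : BddAbove (Set.range fun τ : traceSpace A =>
    Real.sqrt ((τ : WeakDual ℂ A) (star a * a)).re) :=
  ⟨‖a‖, by rintro _ ⟨τ, rfl⟩; exact (traceSpace.sqrt_facts τ.2).2.2.2 a⟩

lemma uniformTwoNorm_nonneg (a : A) : 0 ≤ uniformTwoNorm a :=
  Real.iSup_nonneg fun _ => Real.sqrt_nonneg _

lemma sqrt_le_uniformTwoNorm (τ : traceSpace A) (a : A) :
    Real.sqrt ((τ : WeakDual ℂ A) (star a * a)).re ≤ uniformTwoNorm a :=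
  le_ciSup (uniformTwoNorm_bddAbove a) τ

lemma uniformTwoNorm_zero : uniformTwoNorm (0 : A) = 0 := by
  simp [uniformTwoNorm]

lemma uniformTwoNorm_add_le (a b : A) :
    uniformTwoNorm (a + b) ≤ uniformTwoNorm a + uniformTwoNorm b :=
  Real.iSup_le (fun τ => ((traceSpace.sqrt_facts τ.2).1 a b).trans
    (add_le_add (sqrt_le_uniformTwoNorm τ a) (sqrt_le_uniformTwoNorm τ b)))
    (add_nonneg (uniformTwoNorm_nonneg a) (uniformTwoNorm_nonneg b))

lemma uniformTwoNorm_star (a : A) : uniformTwoNorm (star a) = uniformTwoNorm a :=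
  iSup_congr fun τ => (traceSpace.sqrt_facts τ.2).2.2.1 a

lemma uniformTwoNorm_mul_le (a b : A) : uniformTwoNorm (a * b) ≤ ‖a‖ * uniformTwoNorm b :=
  Real.iSup_le (fun τ => ((traceSpace.sqrt_facts τ.2).2.1 a b).trans
    (mul_le_mul_of_nonneg_left (sqrt_le_uniformTwoNorm τ b) (norm_nonneg a)))
    (mul_nonneg (norm_nonneg a) (uniformTwoNorm_nonneg b))

lemma uniformTwoNorm_mul_le' (a b : A) : uniformTwoNorm (a * b) ≤ uniformTwoNorm a * ‖b‖ := by
  rw [← uniformTwoNorm_star (a * b), star_mul, mul_comm, ← uniformTwoNorm_star a, ← norm_star b]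
  exact uniformTwoNorm_mul_le _ _

end Traces

/-! ## The uniform tracial ultrapower -/

section Ultrapower

variable (U : Ultrafilter ℕ) (A : Type*) [CStarAlgebra A]

/-- The ideal of those bounded sequences `(aₙ)` in `ℓ^∞(A)` with `lim_{n → U} ‖aₙ‖_{2,T(A)} = 0`.
Here `ℓ^∞(A)` is `ℕ →ᵇ A`, the bounded (automatically continuous) functions from `ℕ` to `A`. -/
def traceNullIdeal : Ideal (ℕ →ᵇ A) where
  carrier := {a | Tendsto (fun n => uniformTwoNorm (a n)) U (𝓝 0)}
  zero_mem' := by simp [uniformTwoNorm_zero]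
  add_mem' {a b} ha hb := by
    have h := Tendsto.add ha hb
    rw [add_zero] at h
    exact squeeze_zero (fun n => uniformTwoNorm_nonneg _)
      (fun n => uniformTwoNorm_add_le (a n) (b n)) h
  smul_mem' c a ha := by
    have h := Tendsto.const_mul ‖c‖ ha
    rw [mul_zero] at h
    exact squeeze_zero (fun n => uniformTwoNorm_nonneg _)
      (fun n => (uniformTwoNorm_mul_le (c n) (a n)).trans
        (mul_le_mul_of_nonneg_right (c.norm_coe_le_norm n) (uniformTwoNorm_nonneg _))) h

instance traceNullIdeal.isTwoSided : (traceNullIdeal U A).IsTwoSided where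
  mul_mem_of_left {a} b ha := by
    have h := Tendsto.mul_const ‖b‖ (show Tendsto (fun n => uniformTwoNorm (a n)) U (𝓝 0) from ha)
    rw [zero_mul] at h
    exact squeeze_zero (fun n => uniformTwoNorm_nonneg _)
      (fun n => (uniformTwoNorm_mul_le' (a n) (b n)).trans
        (mul_le_mul_of_nonneg_left (b.norm_coe_le_norm n) (uniformTwoNorm_nonneg _))) h

lemma traceNullIdeal.star_mem {a : ℕ →ᵇ A} (ha : a ∈ traceNullIdeal U A) :
    star a ∈ traceNullIdeal U A := by
  have h : (fun n => uniformTwoNorm ((star a) n)) = fun n => uniformTwoNorm (a n) :=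
    funext fun n => uniformTwoNorm_star (a n)
  change Tendsto (fun n => uniformTwoNorm ((star a) n)) U (𝓝 0)
  rw [h]
  exact ha

/-- The uniform tracial ultrapower
`A^U = ℓ^∞(A) / {(aₙ) : lim_{n → U} ‖aₙ‖_{2,T(A)} = 0}`, as a unital complex ⋆-algebra. -/
def TracialUltrapower : Type _ := (ℕ →ᵇ A) ⧸ traceNullIdeal U A

namespace TracialUltrapower

instance : Ring (TracialUltrapower U A) :=
  inferInstanceAs (Ring ((ℕ →ᵇ A) ⧸ traceNullIdeal U A))

instance : Algebra ℂ (TracialUltrapower U A) :=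
  inferInstanceAs (Algebra ℂ ((ℕ →ᵇ A) ⧸ traceNullIdeal U A))

variable {A}

/-- The quotient map `ℓ^∞(A) → A^U`. -/
def mk : (ℕ →ᵇ A) →ₐ[ℂ] TracialUltrapower U A := Ideal.Quotient.mkₐ ℂ (traceNullIdeal U A)

lemma mk_surjective : Function.Surjective (mk U : (ℕ →ᵇ A) → TracialUltrapower U A) :=
  Ideal.Quotient.mk_surjective

lemma mk_eq_mk_iff {a b : ℕ →ᵇ A} :
    mk U a = mk U b ↔ Tendsto (fun n => uniformTwoNorm (a n - b n)) U (𝓝 0) :=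
  Ideal.Quotient.mk_eq_mk_iff_sub_mem a b

/-- The involution of `A^U`, induced by the entrywise involution on sequences. -/
instance : StarRing (TracialUltrapower U A) where
  star := Quotient.map' star (fun a b hab => by
    rw [Submodule.quotientRel_def] at hab ⊢
    rw [← star_sub]
    exact traceNullIdeal.star_mem U A hab)
  star_involutive x := by
    obtain ⟨a, rfl⟩ := mk_surjective U x
    exact congrArg (mk U) (star_star a)
  star_mul x y := by
    obtain ⟨a, rfl⟩ := mk_surjective U x
    obtain ⟨b, rfl⟩ := mk_surjective U y
    exact congrArg (mk U) (star_mul a b)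
  star_add x y := by
    obtain ⟨a, rfl⟩ := mk_surjective U x
    obtain ⟨b, rfl⟩ := mk_surjective U y
    exact congrArg (mk U) (star_add a b)

lemma star_mk (a : ℕ →ᵇ A) : star (mk U a) = mk U (star a) := rfl

/-- The class in `A^U` of the constant sequence `a`. -/
def const (a : A) : TracialUltrapower U A := mk U (BoundedContinuousFunction.const ℕ a)

/-- The image `κ(D^U) ⊆ A^U` of the canonical map `κ : D^U → A^U`: all elements of `A^U` that are
represented by a bounded sequence in `D`. -/
def kappaRange (D : StarSubalgebra ℂ A) : Set (TracialUltrapower U A) :=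
  {x | ∃ d : ℕ →ᵇ A, (∀ n, d n ∈ D) ∧ mk U d = x}

variable (A)

/-- The set `T_U(A)` of limit traces on `A^U`: the functionals
`[(aₙ)] ↦ lim_{n → U} τₙ(aₙ)` induced by sequences `(τₙ)` in `T(A)`. -/
def limitTraces : Set (TracialUltrapower U A →ₗ[ℂ] ℂ) :=
  {τ | ∃ t : ℕ → WeakDual ℂ A, (∀ n, t n ∈ traceSpace A) ∧
    ∀ a : ℕ →ᵇ A, Tendsto (fun n => t n (a n)) U (𝓝 (τ (mk U a)))}

end TracialUltrapower

end Ultrapower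

open TracialUltrapower in
/-- Uniform property Γ (with respect to the ultrafilter `U`) of a unital sub-C⋆-algebra `(D ⊆ A)`.
The notion is only defined when `A` is separable and `T(A)` is nonempty and weak-⋆ compact, so
these are part of the assertion that `(D ⊆ A)` has the property. -/
structure HasUniformPropertyGamma (U : Ultrafilter ℕ) {A : Type*} [CStarAlgebra A]
    (D : StarSubalgebra ℂ A) : Prop where
  isClosed : IsClosed (D : Set A)
  separable : TopologicalSpace.SeparableSpace A
  nonempty_traceSpace : (traceSpace A).Nonempty
  isCompact_traceSpace : IsCompact (traceSpace A)
  /-- The inclusion `κ(D^U) ⊆ A^U` is unital. -/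
  one_mem : (1 : TracialUltrapower U A) ∈ kappaRange U D
  exists_partition : ∀ k : ℕ, 0 < k → ∃ q : Fin k → TracialUltrapower U A,
    (∀ i, IsStarProjection (q i)) ∧
    (∀ i, q i ∈ kappaRange U D ∩ Set.centralizer (Set.range (const U : A → _))) ∧
    ∑ i, q i = 1 ∧
    ∀ τ ∈ limitTraces U A, ∀ a ∈ D, ∀ i,
      τ (q i * const U a) = (1 / (k : ℂ)) * τ (const U a)

/-! ## The minimal tensor product -/

section UniversalRepresentation

variable (A : Type*) [CStarAlgebra A] [PartialOrder A] [StarOrderedRing A]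

/-- The states of a unital C⋆-algebra. -/
def StateSpace : Type _ := {φ : A →ₚ[ℂ] ℂ // φ 1 = 1}

/-- The Hilbert space of the universal representation: the Hilbert sum of the GNS spaces of all
states of `A`. -/
abbrev UniversalHilbert : Type _ := lp (fun φ : StateSpace A => φ.1.GNS) 2

/-- The universal representation of `A`: the direct sum of the GNS representations of all
states of `A`. -/
def universalRep : A →⋆ₐ[ℂ] (UniversalHilbert A →L[ℂ] UniversalHilbert A) where
  toFun a := lp.mapCLM 2 (fun φ : StateSpace A => φ.1.gnsStarAlgHom a) (norm_nonneg a)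
    (fun φ => NonUnitalStarAlgHom.norm_apply_le φ.1.gnsStarAlgHom a)
  map_one' := by
    ext v φ
    simp [lp.mapCLM]
  map_mul' a b := by
    ext v φ
    simp [lp.mapCLM]
  map_zero' := by
    ext v φ
    simp [lp.mapCLM]
  map_add' a b := by
    ext v φ
    change φ.1.gnsStarAlgHom (a + b) (v φ) = φ.1.gnsStarAlgHom a (v φ) + φ.1.gnsStarAlgHom b (v φ)
    rw [map_add]
    rfl
  commutes' r := by
    ext v φ
    change φ.1.gnsStarAlgHom (algebraMap ℂ A r) (v φ) = r • v φ
    rw [AlgHomClass.commutes, Algebra.algebraMap_eq_smul_one]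
    rfl
  map_star' a := by
    refine (ContinuousLinearMap.eq_adjoint_iff _ _).mpr fun v w => ?_
    rw [lp.inner_eq_tsum, lp.inner_eq_tsum]
    refine tsum_congr fun φ => ?_
    change inner ℂ (φ.1.gnsStarAlgHom (star a) (v φ)) (w φ) =
      inner ℂ (v φ) (φ.1.gnsStarAlgHom a (w φ))
    rw [map_star, ContinuousLinearMap.star_eq_adjoint, ContinuousLinearMap.adjoint_inner_left]

end UniversalRepresentation

section MinTensor

/-- The Hilbert space tensor product of `H` and `K`: the completion of the algebraic tensor product
in the inner product `⟨x ⊗ y, x' ⊗ y'⟩ = ⟨x, x'⟩ ⟨y, y'⟩`. -/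
def HilbertTensor (H K : Type*) [NormedAddCommGroup H] [InnerProductSpace ℂ H]
    [NormedAddCommGroup K] [InnerProductSpace ℂ K] : Type _ :=
  UniformSpace.Completion (H ⊗[ℂ] K)

namespace HilbertTensor

variable {H K : Type*} [NormedAddCommGroup H] [InnerProductSpace ℂ H]
    [NormedAddCommGroup K] [InnerProductSpace ℂ K]

instance : NormedAddCommGroup (HilbertTensor H K) :=
  inferInstanceAs (NormedAddCommGroup (UniformSpace.Completion (H ⊗[ℂ] K)))

instance : InnerProductSpace ℂ (HilbertTensor H K) :=
  inferInstanceAs (InnerProductSpace ℂ (UniformSpace.Completion (H ⊗[ℂ] K)))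

instance : CompleteSpace (HilbertTensor H K) :=
  inferInstanceAs (CompleteSpace (UniformSpace.Completion (H ⊗[ℂ] K)))

/-- The operator `S ⊗ T` on the Hilbert space tensor product, the bounded extension of
`x ⊗ y ↦ S x ⊗ T y`. -/
def mapOp (S : H →L[ℂ] H) (T : K →L[ℂ] K) : HilbertTensor H K →L[ℂ] HilbertTensor H K :=
  (TensorProduct.mapL S T).completion

end HilbertTensor

/-- The C⋆-subalgebra generated by a subset of a unital C⋆-algebra. -/
def cstarGenerated {A : Type*} [CStarAlgebra A] (s : Set A) : StarSubalgebra ℂ A :=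
  (StarAlgebra.adjoin ℂ s).topologicalClosure

lemma subset_cstarGenerated {A : Type*} [CStarAlgebra A] (s : Set A) :
    s ⊆ (cstarGenerated s : Set A) :=
  (StarAlgebra.subset_adjoin ℂ s).trans (StarSubalgebra.le_topologicalClosure _)

lemma isClosed_cstarGenerated {A : Type*} [CStarAlgebra A] (s : Set A) :
    IsClosed (cstarGenerated s : Set A) :=
  StarSubalgebra.isClosed_topologicalClosure _

/-- The spatial tensor product of two representations `π : A → B(H)` and `ρ : B → B(K)`: the
C⋆-algebra of operators on the Hilbert space tensor product of `H` and `K` generated by the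
operators `π a ⊗ ρ b`. -/
def spatialTensor {A B H K : Type*} [CStarAlgebra A] [CStarAlgebra B]
    [NormedAddCommGroup H] [InnerProductSpace ℂ H] [CompleteSpace H]
    [NormedAddCommGroup K] [InnerProductSpace ℂ K] [CompleteSpace K]
    (π : A →⋆ₐ[ℂ] (H →L[ℂ] H)) (ρ : B →⋆ₐ[ℂ] (K →L[ℂ] K)) :
    StarSubalgebra ℂ (HilbertTensor H K →L[ℂ] HilbertTensor H K) :=
  cstarGenerated {x | ∃ (a : A) (b : B), HilbertTensor.mapOp (π a) (ρ b) = x}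

instance spatialTensor.instCStarAlgebra {A B H K : Type*} [CStarAlgebra A] [CStarAlgebra B]
    [NormedAddCommGroup H] [InnerProductSpace ℂ H] [CompleteSpace H]
    [NormedAddCommGroup K] [InnerProductSpace ℂ K] [CompleteSpace K]
    (π : A →⋆ₐ[ℂ] (H →L[ℂ] H)) (ρ : B →⋆ₐ[ℂ] (K →L[ℂ] K)) :
    CStarAlgebra (spatialTensor π ρ) :=
  StarSubalgebra.cstarAlgebra _ (h_closed := isClosed_cstarGenerated _)

variable (A B : Type*) [CStarAlgebra A] [PartialOrder A] [StarOrderedRing A]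
  [CStarAlgebra B] [PartialOrder B] [StarOrderedRing B]

/-- The minimal (spatial) tensor product `A ⊗ B` of unital C⋆-algebras: the spatial tensor product
of the universal representations, which are faithful. -/
def MinTensor : Type _ := spatialTensor (universalRep A) (universalRep B)

namespace MinTensor

instance : CStarAlgebra (MinTensor A B) :=
  spatialTensor.instCStarAlgebra (universalRep A) (universalRep B)

variable {A B}

/-- The elementary tensor `a ⊗ b` in the minimal tensor product. -/
def tmul (a : A) (b : B) : MinTensor A B :=
  ⟨HilbertTensor.mapOp (universalRep A a) (universalRep B b),
    subset_cstarGenerated _ ⟨a, b, rfl⟩⟩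

/-- The sub-C⋆-algebra `D_A ⊗ D_B` of `A ⊗ B`: the C⋆-subalgebra generated by the elementary
tensors `d ⊗ e` with `d ∈ D_A` and `e ∈ D_B`. Since the minimal tensor product preserves
inclusions, this is the minimal tensor product of `D_A` and `D_B`. -/
def subalgebra (DA : StarSubalgebra ℂ A) (DB : StarSubalgebra ℂ B) :
    StarSubalgebra ℂ (MinTensor A B) :=
  cstarGenerated {x | ∃ d ∈ DA, ∃ e ∈ DB, tmul d e = x}

end MinTensor

end MinTensor

end

/-!
The partition of unity for `D_A ⊗ D_B ⊆ A ⊗ B` is the image of one for `D_A ⊆ A` under `a ↦ a ⊗ 1`.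

A unital ⋆-homomorphism pulls tracial states back to tracial states, so it contracts the uniform
2-seminorms (`uniformTwoNorm_map_le`) and induces a ⋆-homomorphism of tracial ultrapowers
(`TracialUltrapower.map`). Hence the images of the projections `q₁, …, q_k` are projections with sum
`1`, represented by sequences in `D_A ⊗ 1 ⊆ D_A ⊗ D_B`. They commute with `A ⊗ 1` because the `qᵢ`
commute with `A`, and with `1 ⊗ B` already entrywise; as the commutant of an element of the
ultrapower meets `A ⊗ B` in a norm-closed subspace, they commute with all of `A ⊗ B`
(`MinTensor.commute_const_map_inclLeft`).

For the trace identity, linearity and continuity reduce the second variable to an elementary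
tensor `d ⊗ e`, and then to `e = y⋆y + 1`. For a tracial state `τ` of `A ⊗ B`, the slice
`a ↦ τ(a ⊗ e)` is then a multiple of a tracial state of `A` (`MinTensor.exists_trace_slice`), so a
limit trace of `A ⊗ B`, sliced by `e`, is a multiple of a limit trace of `A`, to which the hypothesis
applies (`MinTensor.limitTrace_map_inclLeft_mul_const_tmul`).

The remaining requirements are that `A ⊗ B` is separable (`MinTensor.separableSpace`), that its trace
space is compact by Banach–Alaoglu (`traceSpace.isCompact`), and that it has a trace: two tracial
states are vector functionals of the universal representations, and the tensor product of the two
vectors implements their product (`MinTensor.nonempty_traceSpace`).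
-/

noncomputable section

/-! ### Tracial states -/

section TracialStates

variable {A C : Type*} [CStarAlgebra A] [CStarAlgebra C]

namespace traceSpace

/-- Cauchy–Schwarz for a tracial state: `|τ(a)| ≤ τ(a⋆a)^{1/2}`. -/
lemma norm_apply_le_sqrt {τ : WeakDual ℂ A} (hτ : τ ∈ traceSpace A) (a : A) :
    ‖τ a‖ ≤ Real.sqrt (τ (star a * a)).re := by
  let _ := CStarAlgebra.spectralOrder A
  have := CStarAlgebra.spectralOrderedRing A
  let f : A →ₚ[ℂ] ℂ := PositiveLinearMap.mk₀
    { toFun := fun a => τ a, map_add' := map_add τ, map_smul' := map_smul τ } (by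
      intro x hx
      obtain ⟨y, rfl⟩ := CStarAlgebra.nonneg_iff_eq_star_mul_self.mp hx
      exact hτ.1 y)
  have hf : ∀ x, f x = τ x := fun _ => rfl
  have h := norm_inner_le_norm (𝕜 := ℂ) (f.toPreGNS 1) (f.toPreGNS a)
  rw [f.preGNS_inner_def, f.preGNS_norm_def, f.preGNS_norm_def] at h
  simpa [hf, hτ.2.1] using h

lemma norm_apply_le {τ : WeakDual ℂ A} (hτ : τ ∈ traceSpace A) (a : A) : ‖τ a‖ ≤ ‖a‖ :=
  (norm_apply_le_sqrt hτ a).trans ((sqrt_facts hτ).2.2.2 a)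

lemma norm_apply_le_uniformTwoNorm {τ : WeakDual ℂ A} (hτ : τ ∈ traceSpace A) (a : A) :
    ‖τ a‖ ≤ uniformTwoNorm a :=
  (norm_apply_le_sqrt hτ a).trans (sqrt_le_uniformTwoNorm ⟨τ, hτ⟩ a)

variable (A) in
/-- Banach–Alaoglu: the trace space of a unital C⋆-algebra is weak-⋆ compact. -/
lemma isCompact : IsCompact (traceSpace A) := by
  have ev : ∀ a : A, Continuous fun τ : WeakDual ℂ A => τ a := WeakDual.eval_continuous
  refine (WeakDual.isCompact_closedBall (𝕜 := ℂ) (0 : StrongDual ℂ A) 1).of_isClosed_subset ?_ ?_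
  · have h : traceSpace A = (⋂ a : A, {τ | 0 ≤ τ (star a * a)}) ∩
        ({τ | τ 1 = 1} ∩ ⋂ a : A, ⋂ b : A, {τ | τ (a * b) = τ (b * a)}) := by
      ext τ
      simp [traceSpace]
    rw [h]
    exact (isClosed_iInter fun a => isClosed_le continuous_const (ev _)).inter
      ((isClosed_eq (ev _) continuous_const).inter
        (isClosed_iInter fun a => isClosed_iInter fun b => isClosed_eq (ev _) (ev _)))
  · intro τ hτ
    simp only [Set.mem_preimage, mem_closedBall_zero_iff]
    refine ContinuousLinearMap.opNorm_le_bound _ zero_le_one fun a => ?_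
    rw [one_mul]
    exact norm_apply_le hτ a

/-- The pull-back of a tracial state along a unital ⋆-homomorphism is a tracial state. -/
lemma exists_comp (φ : A →⋆ₐ[ℂ] C) {τ : WeakDual ℂ C} (hτ : τ ∈ traceSpace C) :
    ∃ σ ∈ traceSpace A, ∀ a, σ a = τ (φ a) := by
  let φL : A →L[ℂ] C := φ.toAlgHom.toLinearMap.mkContinuous 1 fun a => by
    rw [one_mul]
    exact NonUnitalStarAlgHom.norm_apply_le φ a
  let σ : A →L[ℂ] ℂ := (WeakDual.toStrongDual τ).comp φL
  have hσ : ∀ a, StrongDual.toWeakDual σ a = τ (φ a) := fun _ => rfl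
  refine ⟨StrongDual.toWeakDual σ, ⟨fun a => ?_, ?_, fun a b => ?_⟩, hσ⟩
  · rw [hσ, map_mul, map_star]
    exact hτ.1 _
  · rw [hσ, map_one, hτ.2.1]
  · rw [hσ, hσ, map_mul φ, map_mul φ, hτ.2.2]

end traceSpace

/-- Unital ⋆-homomorphisms contract the uniform 2-seminorms, as traces pull back to traces. -/
lemma uniformTwoNorm_map_le (φ : A →⋆ₐ[ℂ] C) (a : A) :
    uniformTwoNorm (φ a) ≤ uniformTwoNorm a := by
  refine Real.iSup_le (fun τ => ?_) (uniformTwoNorm_nonneg a)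
  obtain ⟨σ, hσ, h⟩ := traceSpace.exists_comp φ τ.2
  rw [← map_star, ← map_mul, ← h]
  exact sqrt_le_uniformTwoNorm ⟨σ, hσ⟩ a

lemma uniformTwoNorm_le_norm (a : A) : uniformTwoNorm a ≤ ‖a‖ :=
  Real.iSup_le (fun τ => (traceSpace.sqrt_facts τ.2).2.2.2 a) (norm_nonneg a)

end TracialStates

/-! ### Functoriality of the tracial ultrapower and limit traces -/

namespace TracialUltrapower

variable {U : Ultrafilter ℕ} {A C : Type*} [CStarAlgebra A] [CStarAlgebra C]

/-- The entrywise application of a unital ⋆-homomorphism to bounded sequences. -/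
def mapSeq (φ : A →⋆ₐ[ℂ] C) : (ℕ →ᵇ A) →ₐ[ℂ] (ℕ →ᵇ C) :=
  BoundedContinuousFunction.AlgHom.compLeftContinuousBounded (α := ℕ) ℂ φ.toAlgHom
    (C := 1) (LipschitzWith.of_dist_le_mul fun a b => by
      rw [dist_eq_norm, dist_eq_norm, NNReal.coe_one, one_mul]
      exact (map_sub φ a b).symm ▸ NonUnitalStarAlgHom.norm_apply_le φ (a - b))

@[simp] lemma mapSeq_apply (φ : A →⋆ₐ[ℂ] C) (a : ℕ →ᵇ A) (n : ℕ) : mapSeq φ a n = φ (a n) := rfl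

variable (U) in
/-- The homomorphism `A^U → C^U` induced by a unital ⋆-homomorphism `A → C`. -/
def map (φ : A →⋆ₐ[ℂ] C) : TracialUltrapower U A →+* TracialUltrapower U C :=
  Ideal.Quotient.lift (traceNullIdeal U A) ((mk U).toRingHom.comp (mapSeq φ).toRingHom)
    fun a ha => (mk_eq_mk_iff U (a := mapSeq φ a) (b := 0)).2 <|
      squeeze_zero (fun n => uniformTwoNorm_nonneg _) (fun n => by
        simpa using uniformTwoNorm_map_le φ (a n)) ha

lemma map_mk (φ : A →⋆ₐ[ℂ] C) (a : ℕ →ᵇ A) : map U φ (mk U a) = mk U (mapSeq φ a) := rfl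

lemma map_const (φ : A →⋆ₐ[ℂ] C) (a : A) : map U φ (const U a) = const U (φ a) := rfl

lemma const_zero : const U (0 : A) = 0 := map_zero (mk U)

lemma const_add (a b : A) : const U (a + b) = const U a + const U b :=
  map_add (mk U) (.const ℕ a) (.const ℕ b)

lemma const_smul (c : ℂ) (a : A) : const U (c • a) = c • const U a :=
  map_smul (mk U) c (.const ℕ a)

lemma const_mul (a b : A) : const U (a * b) = const U a * const U b :=
  map_mul (mk U) (.const ℕ a) (.const ℕ b)

lemma map_star (φ : A →⋆ₐ[ℂ] C) (x : TracialUltrapower U A) :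
    map U φ (star x) = star (map U φ x) := by
  obtain ⟨a, rfl⟩ := mk_surjective U x
  rw [star_mk, map_mk, map_mk, star_mk]
  congr 1
  ext n
  exact StarHomClass.map_star φ (a n)

lemma isStarProjection_map (φ : A →⋆ₐ[ℂ] C) {q : TracialUltrapower U A}
    (hq : IsStarProjection q) : IsStarProjection (map U φ q) where
  isIdempotentElem := by
    rw [IsIdempotentElem, ← map_mul, hq.isIdempotentElem.eq]
  isSelfAdjoint := by
    rw [IsSelfAdjoint, ← map_star, hq.isSelfAdjoint.star_eq]

variable (U) in
/-- Bounded sequences of functionals in the unit ball have pointwise limits along an ultrafilter;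
for tracial states the limit descends to `A^U`, so every sequence in `T(A)` defines a limit
trace. -/
lemma exists_limitTrace (t : ℕ → WeakDual ℂ A) (ht : ∀ n, t n ∈ traceSpace A) :
    ∃ τ ∈ limitTraces U A, ∀ a : ℕ →ᵇ A, Tendsto (fun n => t n (a n)) U (𝓝 (τ (mk U a))) := by
  have hlim : ∀ a : ℕ →ᵇ A, ∃ z : ℂ, Tendsto (fun n => t n (a n)) U (𝓝 z) := fun a => by
    obtain ⟨z, -, hz⟩ := (isCompact_closedBall (0 : ℂ) ‖a‖).ultrafilter_le_nhds
      (U.map fun n => t n (a n)) (by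
        rw [Ultrafilter.coe_map, le_principal_iff, mem_map]
        refine Filter.univ_mem' fun n => ?_
        simpa using (traceSpace.norm_apply_le (ht n) (a n)).trans (a.norm_coe_le_norm n))
    exact ⟨z, hz⟩
  choose L hL using hlim
  let Λ : (ℕ →ᵇ A) →ₗ[ℂ] ℂ :=
    { toFun := L
      map_add' := fun a b => tendsto_nhds_unique (hL (a + b)) <| by
        simpa using (hL a).add (hL b)
      map_smul' := fun c a => tendsto_nhds_unique (hL (c • a)) <| by
        simpa using (hL a).const_mul c }
  have hΛ : ∀ a b : ℕ →ᵇ A, mk U a = mk U b → L a = L b := fun a b hab => by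
    have h0 : Tendsto (fun n => t n (a n - b n)) U (𝓝 0) :=
      squeeze_zero_norm (fun n => traceSpace.norm_apply_le_uniformTwoNorm (ht n) _)
        ((mk_eq_mk_iff U).1 hab)
    have h1 := (hL a).sub (hL b)
    simp only [← map_sub] at h1
    exact sub_eq_zero.1 (tendsto_nhds_unique h1 h0)
  -- a linear section of the quotient map turns the limit functional into one on `A^U`
  obtain ⟨s, hs⟩ := (mk U (A := A)).toLinearMap.exists_rightInverse_of_surjective
    (LinearMap.range_eq_top.2 (mk_surjective U))
  have key : ∀ a : ℕ →ᵇ A,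
      Tendsto (fun n => t n (a n)) U (𝓝 ((Λ ∘ₗ s) (mk U a))) := fun a => by
    have : L (s (mk U a)) = L a := hΛ _ _ (LinearMap.congr_fun hs (mk U a))
    change Tendsto _ _ (𝓝 (L (s (mk U a))))
    rw [this]
    exact hL a
  exact ⟨Λ ∘ₗ s, ⟨t, ht, key⟩, key⟩

lemma commute_const_mk_iff (a : A) (b : ℕ →ᵇ A) : Commute (const U a) (mk U b) ↔
    Tendsto (fun n => uniformTwoNorm (a * b n - b n * a)) U (𝓝 0) := by
  rw [commute_iff_eq, const, ← map_mul, ← map_mul, mk_eq_mk_iff]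
  rfl

/-- The elements of `A` whose class commutes with `x ∈ A^U` form a norm-closed set. -/
lemma isClosed_setOf_commute_const (x : TracialUltrapower U A) :
    IsClosed {a : A | Commute (const U a) x} := by
  obtain ⟨b, rfl⟩ := mk_surjective U x
  refine isClosed_of_closure_subset fun a ha => ?_
  refine (commute_const_mk_iff a b).2 ?_
  refine Metric.tendsto_nhds.2 fun ε hε => ?_
  -- a commutator `[a, bₙ]` moves by at most `2 ‖a - c‖ ‖b‖` when `a` is replaced by `c`
  obtain ⟨c, hc, hac⟩ := Metric.mem_closure_iff.1 ha (ε / 2 / (2 * (‖b‖ + 1))) (by positivity)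
  have hc' := (commute_const_mk_iff c b).1 hc
  filter_upwards [Metric.tendsto_nhds.1 hc' (ε / 2) (half_pos hε)] with n hn
  rw [Real.dist_0_eq_abs, abs_of_nonneg (uniformTwoNorm_nonneg _)] at hn ⊢
  have hb := b.norm_coe_le_norm n
  have hd : ‖a - c‖ * (2 * (‖b‖ + 1)) < ε / 2 := by
    rw [dist_eq_norm] at hac
    exact (lt_div_iff₀ (by positivity)).1 hac
  have hle : ‖(a - c) * b n - b n * (a - c)‖ ≤ ‖a - c‖ * (2 * (‖b‖ + 1)) :=
    calc _ ≤ ‖a - c‖ * ‖b n‖ + ‖b n‖ * ‖a - c‖ :=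
          (norm_sub_le _ _).trans (add_le_add (norm_mul_le _ _) (norm_mul_le _ _))
      _ ≤ _ := by nlinarith [norm_nonneg (a - c)]
  have hsplit : a * b n - b n * a =
      (c * b n - b n * c) + ((a - c) * b n - b n * (a - c)) := by noncomm_ring
  calc uniformTwoNorm (a * b n - b n * a)
      ≤ uniformTwoNorm (c * b n - b n * c) +
        uniformTwoNorm ((a - c) * b n - b n * (a - c)) := hsplit ▸ uniformTwoNorm_add_le _ _
    _ < ε / 2 + ε / 2 := add_lt_add hn ((uniformTwoNorm_le_norm _).trans_lt (hle.trans_lt hd))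
    _ = ε := add_halves ε

end TracialUltrapower

/-! ### Elementary tensors in the minimal tensor product -/

namespace HilbertTensor

variable {H K : Type*} [NormedAddCommGroup H] [InnerProductSpace ℂ H]
    [NormedAddCommGroup K] [InnerProductSpace ℂ K]

/-- The elementary tensor `x ⊗ y` in the Hilbert space tensor product. -/
def tmul (x : H) (y : K) : HilbertTensor H K := ((x ⊗ₜ[ℂ] y : H ⊗[ℂ] K) : UniformSpace.Completion _)

lemma mapOp_tmul (S : H →L[ℂ] H) (T : K →L[ℂ] K) (x : H) (y : K) :
    mapOp S T (tmul x y) = tmul (S x) (T y) :=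
  ContinuousLinearMap.completion_apply_coe _ _

lemma inner_tmul (x x' : H) (y y' : K) :
    inner ℂ (tmul x y) (tmul x' y') = inner ℂ x x' * inner ℂ y y' :=
  (UniformSpace.Completion.inner_coe _ _).trans (TensorProduct.inner_tmul ℂ x x' y y')

/-- A closed property which is additive holds on the Hilbert space tensor product once it holds for
elementary tensors. -/
lemma induction_on {p : HilbertTensor H K → Prop} (hc : IsClosed {z | p z}) (h0 : p 0)
    (ht : ∀ x y, p (tmul x y)) (ha : ∀ z w, p z → p w → p (z + w)) (z : HilbertTensor H K) :
    p z := by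
  refine UniformSpace.Completion.induction_on (p := p) z hc fun u => ?_
  induction u with
  | zero => exact h0
  | tmul x y => exact ht x y
  | add u v hu hv =>
    rw [UniformSpace.Completion.coe_add]
    exact ha _ _ hu hv

lemma clm_ext {S T : HilbertTensor H K →L[ℂ] HilbertTensor H K}
    (h : ∀ x y, S (tmul x y) = T (tmul x y)) : S = T := by
  ext z
  induction z using induction_on with
  | hc => exact isClosed_eq S.continuous T.continuous
  | h0 => simp
  | ht x y => exact h x y
  | ha z w hz hw => rw [map_add, map_add, hz, hw]

lemma tmul_add (x : H) (y y' : K) : tmul x (y + y') = tmul x y + tmul x y' := by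
  simp only [tmul, TensorProduct.tmul_add, UniformSpace.Completion.coe_add]; rfl

lemma add_tmul (x x' : H) (y : K) : tmul (x + x') y = tmul x y + tmul x' y := by
  simp only [tmul, TensorProduct.add_tmul, UniformSpace.Completion.coe_add]; rfl

lemma tmul_smul (c : ℂ) (x : H) (y : K) : tmul x (c • y) = c • tmul x y := by
  simp only [tmul, TensorProduct.tmul_smul, UniformSpace.Completion.coe_smul]; rfl

lemma smul_tmul (c : ℂ) (x : H) (y : K) : tmul (c • x) y = c • tmul x y := by
  simp only [tmul, ← TensorProduct.smul_tmul', UniformSpace.Completion.coe_smul]; rfl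

lemma star_mapOp [CompleteSpace H] [CompleteSpace K] (S : H →L[ℂ] H) (T : K →L[ℂ] K) :
    star (mapOp S T) = mapOp (star S) (star T) := by
  refine ((ContinuousLinearMap.eq_adjoint_iff _ _).2 fun z w => ?_).symm
  induction z using induction_on with
  | hc => exact isClosed_eq (by fun_prop) (by fun_prop)
  | h0 => simp
  | ha z z' hz hz' => rw [map_add, inner_add_left, inner_add_left, hz, hz']
  | ht x y =>
    induction w using induction_on with
    | hc => exact isClosed_eq (by fun_prop) (by fun_prop)
    | h0 => simp
    | ha w w' hw hw' => rw [map_add, inner_add_right, inner_add_right, hw, hw']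
    | ht x' y' =>
      rw [mapOp_tmul, mapOp_tmul, inner_tmul, inner_tmul, ContinuousLinearMap.star_eq_adjoint,
        ContinuousLinearMap.star_eq_adjoint, ContinuousLinearMap.adjoint_inner_left,
        ContinuousLinearMap.adjoint_inner_left]

end HilbertTensor

/-- The C⋆-subalgebra generated by a self-adjoint submonoid is the closure of its linear span. -/
lemma coe_cstarGenerated_of_submonoid {A : Type*} [CStarAlgebra A] (M : Submonoid A)
    (hM : ∀ x ∈ M, star x ∈ M) :
    (cstarGenerated (M : Set A) : Set A) = closure (Submodule.span ℂ (M : Set A) : Set A) := by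
  have hstar : star (M : Set A) = M := by
    ext x
    exact ⟨fun hx => by simpa using hM _ hx, fun hx => hM x hx⟩
  have h : (StarAlgebra.adjoin ℂ (M : Set A) : Set A) = Submodule.span ℂ (M : Set A) := by
    rw [← StarSubalgebra.coe_toSubalgebra, StarAlgebra.adjoin_toSubalgebra, hstar, Set.union_self,
      ← Subalgebra.coe_toSubmodule, Algebra.adjoin_eq_span, Submonoid.closure_eq]
  rw [cstarGenerated, StarSubalgebra.topologicalClosure_coe, h]

namespace MinTensor

variable {A B : Type*} [CStarAlgebra A] [PartialOrder A] [StarOrderedRing A]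
  [CStarAlgebra B] [PartialOrder B] [StarOrderedRing B]

/-- The inclusion of `A ⊗ B` into the bounded operators on the tensor product of the universal
Hilbert spaces. -/
def toOp : MinTensor A B →⋆ₐ[ℂ] (HilbertTensor (UniversalHilbert A) (UniversalHilbert B) →L[ℂ]
    HilbertTensor (UniversalHilbert A) (UniversalHilbert B)) :=
  (spatialTensor (universalRep A) (universalRep B)).subtype

lemma toOp_injective : Function.Injective (toOp (A := A) (B := B)) := Subtype.val_injective

lemma toOp_tmul (a : A) (b : B) :
    toOp (tmul a b) = HilbertTensor.mapOp (universalRep A a) (universalRep B b) := rfl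

lemma isEmbedding_toOp : IsEmbedding (toOp (A := A) (B := B)) := IsEmbedding.subtypeVal

lemma tmul_mul_tmul (a a' : A) (b b' : B) :
    tmul a b * tmul a' b' = tmul (a * a') (b * b') := by
  apply toOp_injective
  rw [map_mul, toOp_tmul, toOp_tmul, toOp_tmul]
  refine HilbertTensor.clm_ext fun x y => ?_
  simp [HilbertTensor.mapOp_tmul]

lemma one_tmul_one : tmul (1 : A) (1 : B) = 1 := by
  apply toOp_injective
  rw [map_one, toOp_tmul]
  refine HilbertTensor.clm_ext fun x y => ?_
  simp [HilbertTensor.mapOp_tmul]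

lemma star_tmul (a : A) (b : B) : star (tmul a b) = tmul (star a) (star b) := by
  apply toOp_injective
  rw [map_star, toOp_tmul, toOp_tmul, HilbertTensor.star_mapOp, map_star, map_star]

lemma add_tmul (a a' : A) (b : B) :
    tmul (a + a') b = tmul a b + tmul a' b :=
  toOp_injective <| HilbertTensor.clm_ext fun x y => by
    simp [toOp_tmul, HilbertTensor.mapOp_tmul, HilbertTensor.add_tmul]

lemma tmul_add (a : A) (b b' : B) :
    tmul a (b + b') = tmul a b + tmul a b' :=
  toOp_injective <| HilbertTensor.clm_ext fun x y => by
    simp [toOp_tmul, HilbertTensor.mapOp_tmul, HilbertTensor.tmul_add]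

lemma smul_tmul (c : ℂ) (a : A) (b : B) :
    tmul (c • a) b = c • tmul a b :=
  toOp_injective <| HilbertTensor.clm_ext fun x y => by
    simp [toOp_tmul, HilbertTensor.mapOp_tmul, HilbertTensor.smul_tmul]

lemma tmul_smul (c : ℂ) (a : A) (b : B) :
    tmul a (c • b) = c • tmul a b :=
  toOp_injective <| HilbertTensor.clm_ext fun x y => by
    simp [toOp_tmul, HilbertTensor.mapOp_tmul, HilbertTensor.tmul_smul]

lemma zero_tmul (b : B) : tmul (0 : A) b = 0 := by
  simpa using smul_tmul (0 : ℂ) (0 : A) b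

lemma tmul_zero (a : A) : tmul a (0 : B) = 0 := by
  simpa using tmul_smul (0 : ℂ) a (0 : B)

/-- The unital ⋆-homomorphism `A → A ⊗ B`, `a ↦ a ⊗ 1`. -/
def inclLeft : A →⋆ₐ[ℂ] MinTensor A B where
  toFun a := tmul a 1
  map_one' := one_tmul_one
  map_mul' a a' := by rw [tmul_mul_tmul, mul_one]
  map_zero' := zero_tmul 1
  map_add' a a' := add_tmul a a' 1
  commutes' c := by
    rw [Algebra.algebraMap_eq_smul_one, smul_tmul, one_tmul_one, Algebra.algebraMap_eq_smul_one]
  map_star' a := by rw [star_tmul, star_one]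

lemma inclLeft_apply (a : A) : inclLeft a = (tmul a 1 : MinTensor A B) := rfl

/-- The unital ⋆-homomorphism `B → A ⊗ B`, `b ↦ 1 ⊗ b`. -/
def inclRight : B →⋆ₐ[ℂ] MinTensor A B where
  toFun b := tmul 1 b
  map_one' := one_tmul_one
  map_mul' b b' := by rw [tmul_mul_tmul, mul_one]
  map_zero' := tmul_zero 1
  map_add' b b' := tmul_add 1 b b'
  commutes' c := by
    rw [Algebra.algebraMap_eq_smul_one, tmul_smul, one_tmul_one, Algebra.algebraMap_eq_smul_one]
  map_star' b := by rw [star_tmul, star_one]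

lemma inclRight_apply (b : B) : inclRight b = (tmul 1 b : MinTensor A B) := rfl

lemma continuous_tmul : Continuous fun p : A × B => tmul p.1 p.2 := by
  have hl : Continuous (inclLeft (A := A) (B := B)) := (inclLeft (A := A)
    (B := B)).toAlgHom.toLinearMap.mkContinuous 1 (fun a => by
      rw [one_mul]; exact NonUnitalStarAlgHom.norm_apply_le inclLeft a) |>.continuous
  have hr : Continuous (inclRight (A := A) (B := B)) := (inclRight (A := A)
    (B := B)).toAlgHom.toLinearMap.mkContinuous 1 (fun a => by
      rw [one_mul]; exact NonUnitalStarAlgHom.norm_apply_le inclRight a) |>.continuous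
  refine ((hl.comp continuous_fst).mul (hr.comp continuous_snd)).congr fun p => ?_
  change inclLeft p.1 * inclRight p.2 = _
  rw [inclLeft_apply, inclRight_apply]
  rw [tmul_mul_tmul, mul_one, one_mul]

/-- The elementary tensors with entries in two given ⋆-subalgebras, as a submonoid. -/
def tmulSubmonoid (DA : StarSubalgebra ℂ A) (DB : StarSubalgebra ℂ B) :
    Submonoid (MinTensor A B) where
  carrier := {x | ∃ d ∈ DA, ∃ e ∈ DB, tmul d e = x}
  one_mem' := ⟨1, one_mem DA, 1, one_mem DB, one_tmul_one⟩
  mul_mem' := by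
    rintro _ _ ⟨d, hd, e, he, rfl⟩ ⟨d', hd', e', he', rfl⟩
    exact ⟨d * d', mul_mem hd hd', e * e', mul_mem he he', (tmul_mul_tmul _ _ _ _).symm⟩

/-- `D_A ⊗ D_B` is the closed linear span of its elementary tensors. -/
lemma coe_subalgebra (DA : StarSubalgebra ℂ A) (DB : StarSubalgebra ℂ B) :
    (subalgebra DA DB : Set (MinTensor A B)) =
      closure (Submodule.span ℂ {x | ∃ d ∈ DA, ∃ e ∈ DB, tmul d e = x}) :=
  coe_cstarGenerated_of_submonoid (tmulSubmonoid DA DB) <| by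
    rintro _ ⟨d, hd, e, he, rfl⟩
    exact ⟨star d, star_mem hd, star e, star_mem he, (star_tmul d e).symm⟩

lemma tmul_mem_subalgebra {DA : StarSubalgebra ℂ A} {DB : StarSubalgebra ℂ B} {d : A} (hd : d ∈ DA)
    {e : B} (he : e ∈ DB) : tmul d e ∈ subalgebra DA DB :=
  subset_cstarGenerated _ ⟨d, hd, e, he, rfl⟩

lemma subalgebra_top : subalgebra (⊤ : StarSubalgebra ℂ A) (⊤ : StarSubalgebra ℂ B) = ⊤ := by
  -- the image of the left-hand side in the operators is closed and contains all generators
  have hcl : IsClosedEmbedding (toOp (A := A) (B := B)) :=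
    (isClosed_cstarGenerated _).isClosedEmbedding_subtypeVal
  let S : StarSubalgebra ℂ (HilbertTensor (UniversalHilbert A) (UniversalHilbert B) →L[ℂ]
      HilbertTensor (UniversalHilbert A) (UniversalHilbert B)) :=
    (subalgebra (⊤ : StarSubalgebra ℂ A) (⊤ : StarSubalgebra ℂ B)).map toOp
  have hS : spatialTensor (universalRep A) (universalRep B) ≤ S := by
    refine StarSubalgebra.topologicalClosure_minimal (StarAlgebra.adjoin_le ?_) ?_
    · rintro _ ⟨a, b, rfl⟩
      exact ⟨tmul a b, tmul_mem_subalgebra (DA := ⊤) (DB := ⊤) trivial trivial, rfl⟩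
    · exact hcl.isClosedMap _ (isClosed_cstarGenerated _)
  refine eq_top_iff.2 fun x _ => ?_
  obtain ⟨y, hy, hyx⟩ := hS x.2
  exact toOp_injective hyx ▸ hy

/-- A closed linear property holds on `D_A ⊗ D_B` once it holds for elementary tensors. -/
lemma subalgebra_induction {DA : StarSubalgebra ℂ A} {DB : StarSubalgebra ℂ B}
    {p : MinTensor A B → Prop} (hc : IsClosed {x | p x}) (h0 : p 0)
    (ht : ∀ d ∈ DA, ∀ e ∈ DB, p (tmul d e)) (ha : ∀ x y, p x → p y → p (x + y))
    (hs : ∀ (c : ℂ) x, p x → p (c • x)) {x : MinTensor A B} (hx : x ∈ subalgebra DA DB) : p x := by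
  rw [← SetLike.mem_coe, coe_subalgebra] at hx
  refine closure_minimal (fun y hy => ?_) hc hx
  induction hy using Submodule.span_induction with
  | mem y hy =>
    obtain ⟨d, hd, e, he, rfl⟩ := hy
    exact ht d hd e he
  | zero => exact h0
  | add y z _ _ hy hz => exact ha y z hy hz
  | smul c y _ hy => exact hs c y hy

lemma induction_on {p : MinTensor A B → Prop} (hc : IsClosed {x | p x}) (h0 : p 0)
    (ht : ∀ a b, p (tmul a b)) (ha : ∀ x y, p x → p y → p (x + y))
    (hs : ∀ (c : ℂ) x, p x → p (c • x)) (x : MinTensor A B) : p x :=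
  subalgebra_induction (DA := ⊤) (DB := ⊤) hc h0 (fun d _ e _ => ht d e) ha hs
    (subalgebra_top (A := A) (B := B) ▸ trivial)

lemma separableSpace [TopologicalSpace.SeparableSpace A] [TopologicalSpace.SeparableSpace B] :
    TopologicalSpace.SeparableSpace (MinTensor A B) := by
  have hr : TopologicalSpace.IsSeparable (Set.range fun p : A × B => tmul p.1 p.2) :=
    TopologicalSpace.isSeparable_range continuous_tmul
  let S : Submodule ℂ (MinTensor A B) :=
    (Submodule.span ℂ (Set.range fun p : A × B => tmul p.1 p.2)).topologicalClosure
  have hS : ∀ x, x ∈ S := fun x => by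
    induction x using induction_on with
    | hc => exact Submodule.isClosed_topologicalClosure _
    | h0 => exact zero_mem _
    | ht a b => exact Submodule.le_topologicalClosure _ (Submodule.subset_span ⟨(a, b), rfl⟩)
    | ha x y hx hy => exact add_mem hx hy
    | hs c x hx => exact S.smul_mem c hx
  exact TopologicalSpace.isSeparable_univ_iff.1 ((hr.span (R := ℂ)).closure.mono fun x _ => hS x)

end MinTensor

/-! ### Product traces -/

/-- Every tracial state is a vector functional of the universal representation, given by the
canonical cyclic vector of its GNS representation. -/
lemma exists_vector_of_mem_traceSpace {A : Type*} [CStarAlgebra A] [PartialOrder A]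
    [StarOrderedRing A] {τ : WeakDual ℂ A} (hτ : τ ∈ traceSpace A) :
    ∃ ξ : UniversalHilbert A, ∀ a, inner ℂ ξ (universalRep A a ξ) = τ a := by
  classical
  let f : A →ₚ[ℂ] ℂ := PositiveLinearMap.mk₀
    { toFun := fun a => τ a, map_add' := map_add τ, map_smul' := map_smul τ } (by
      intro x hx
      obtain ⟨y, rfl⟩ := CStarAlgebra.nonneg_iff_eq_star_mul_self.mp hx
      exact hτ.1 y)
  have hf : ∀ x, f x = τ x := fun _ => rfl
  let φ : StateSpace A := ⟨f, hτ.2.1⟩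
  let η : f.GNS := ((f.toPreGNS 1 : f.PreGNS) : UniformSpace.Completion f.PreGNS)
  refine ⟨lp.single (E := fun φ : StateSpace A => φ.1.GNS) 2 φ η, fun a => ?_⟩
  rw [lp.inner_single_left]
  change inner ℂ η
    (f.gnsStarAlgHom a (lp.single (E := fun φ : StateSpace A => φ.1.GNS) 2 φ η φ)) = τ a
  rw [lp.single_apply_self]
  change inner ℂ η (f.gnsNonUnitalStarAlgHom a η) = τ a
  rw [f.gnsNonUnitalStarAlgHom_apply_coe, UniformSpace.Completion.inner_coe, f.preGNS_inner_def]
  simp [hf]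

namespace MinTensor

variable {A B : Type*} [CStarAlgebra A] [PartialOrder A] [StarOrderedRing A]
  [CStarAlgebra B] [PartialOrder B] [StarOrderedRing B]

/-- The product of two tracial states extends to a tracial state of the minimal tensor product: it
is the vector functional of the tensor product of two vectors implementing the given traces. -/
lemma nonempty_traceSpace (hA : (traceSpace A).Nonempty) (hB : (traceSpace B).Nonempty) :
    (traceSpace (MinTensor A B)).Nonempty := by
  obtain ⟨σ, hσ⟩ := hA
  obtain ⟨ρ, hρ⟩ := hB
  obtain ⟨ξ, hξ⟩ := exists_vector_of_mem_traceSpace hσ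
  obtain ⟨η, hη⟩ := exists_vector_of_mem_traceSpace hρ
  let ζ := HilbertTensor.tmul ξ η
  let opL : MinTensor A B →L[ℂ] _ := ⟨(toOp (A := A) (B := B)).toAlgHom.toLinearMap,
    isEmbedding_toOp.continuous⟩
  let f : MinTensor A B →L[ℂ] ℂ :=
    (innerSL ℂ ζ).comp ((ContinuousLinearMap.apply ℂ _ ζ).comp opL)
  have hf : ∀ x, StrongDual.toWeakDual f x = inner ℂ ζ (toOp x ζ) := fun _ => rfl
  have hft : ∀ a b, f (tmul a b) = σ a * ρ b := fun a b => by
    change inner ℂ ζ (toOp (tmul a b) ζ) = _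
    rw [toOp_tmul, HilbertTensor.mapOp_tmul, HilbertTensor.inner_tmul, hξ, hη]
  refine ⟨StrongDual.toWeakDual f, fun x => ?_, ?_, fun x y => ?_⟩
  · rw [hf, map_mul, map_star, mul_apply_eq_comp, ContinuousLinearMap.star_eq_adjoint,
      ContinuousLinearMap.adjoint_inner_right]
    exact RCLike.nonneg_iff.2 ⟨inner_self_nonneg (𝕜 := ℂ), inner_self_im (𝕜 := ℂ) _⟩
  · rw [← one_tmul_one]
    exact (hft 1 1).trans (by rw [hσ.2.1, hρ.2.1, mul_one])
  · change f (x * y) = f (y * x)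
    induction x using induction_on with
    | hc => exact isClosed_eq (by fun_prop) (by fun_prop)
    | h0 => simp
    | ha x x' hx hx' => rw [add_mul, mul_add, map_add, map_add, hx, hx']
    | hs c x hx => rw [smul_mul_assoc, mul_smul_comm, map_smul, map_smul, hx]
    | ht a b =>
      induction y using induction_on with
      | hc => exact isClosed_eq (by fun_prop) (by fun_prop)
      | h0 => simp
      | ha y y' hy hy' => rw [add_mul, mul_add, map_add, map_add, hy, hy']
      | hs c y hy => rw [smul_mul_assoc, mul_smul_comm, map_smul, map_smul, hy]
      | ht a' b' =>
        rw [tmul_mul_tmul, tmul_mul_tmul, hft, hft, hσ.2.2 a a', hρ.2.2 b b']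

end MinTensor

/-! ### Limit traces on elementary tensors -/

namespace TracialUltrapower

variable {U : Ultrafilter ℕ} {A : Type*} [CStarAlgebra A]

lemma norm_limitTrace_mk_le {τ : TracialUltrapower U A →ₗ[ℂ] ℂ} (hτ : τ ∈ limitTraces U A)
    (a : ℕ →ᵇ A) : ‖τ (mk U a)‖ ≤ ‖a‖ := by
  obtain ⟨t, ht, h⟩ := hτ
  exact le_of_tendsto (h a).norm (Eventually.of_forall fun n =>
    (traceSpace.norm_apply_le (ht n) (a n)).trans (a.norm_coe_le_norm n))

lemma continuous_limitTrace_mul_const {τ : TracialUltrapower U A →ₗ[ℂ] ℂ}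
    (hτ : τ ∈ limitTraces U A) (x : TracialUltrapower U A) :
    Continuous fun a : A => τ (x * const U a) := by
  obtain ⟨b, rfl⟩ := mk_surjective U x
  have hc : Continuous (BoundedContinuousFunction.const ℕ : A → ℕ →ᵇ A) :=
    (LipschitzWith.of_dist_le_mul (K := 1) fun a a' => by
      rw [NNReal.coe_one, one_mul]
      exact (BoundedContinuousFunction.dist_le dist_nonneg).2 fun _ => le_rfl).continuous
  have hL : Continuous ((τ ∘ₗ (mk U).toLinearMap) : (ℕ →ᵇ A) →ₗ[ℂ] ℂ) :=
    ((τ ∘ₗ (mk U).toLinearMap).mkContinuous 1 fun a => by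
      rw [one_mul]
      exact norm_limitTrace_mk_le hτ a).continuous
  refine (hL.comp (continuous_const.mul hc : Continuous fun a : A =>
    b * BoundedContinuousFunction.const ℕ a)).congr fun a => ?_
  exact congrArg τ (map_mul (mk U) b _)

end TracialUltrapower

namespace MinTensor

open TracialUltrapower

variable {U : Ultrafilter ℕ} {A B : Type*} [CStarAlgebra A] [PartialOrder A] [StarOrderedRing A]
  [CStarAlgebra B] [PartialOrder B] [StarOrderedRing B]

lemma continuous_apply_tmul (τ : WeakDual ℂ (MinTensor A B)) (e : B) :
    Continuous fun a : A => τ (tmul a e) := by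
  have h1 : Continuous fun x => τ x := (WeakDual.toStrongDual τ).continuous
  have h2 : Continuous fun a : A => (a, e) := Continuous.prodMk_left e
  exact (h1.comp (continuous_tmul.comp h2)).congr fun _ => rfl

/-- The slice `a ↦ τ(a ⊗ e)` of a functional on `A ⊗ B`, as a linear map. -/
def sliceLinear (τ : WeakDual ℂ (MinTensor A B)) (e : B) : A →ₗ[ℂ] ℂ where
  toFun a := τ (tmul a e)
  map_add' a a' := by rw [add_tmul, map_add]
  map_smul' c a := by rw [smul_tmul, map_smul, RingHom.id_apply]

/-- The slice `a ↦ τ(a ⊗ e)` of a functional on `A ⊗ B`. -/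
def slice (τ : WeakDual ℂ (MinTensor A B)) (e : B) : WeakDual ℂ A :=
  StrongDual.toWeakDual ⟨sliceLinear τ e, continuous_apply_tmul τ e⟩

lemma slice_apply (τ : WeakDual ℂ (MinTensor A B)) (e : B) (a : A) :
    slice τ e a = τ (tmul a e) := rfl

lemma slice_mul_comm {τ : WeakDual ℂ (MinTensor A B)} (hτ : τ ∈ traceSpace (MinTensor A B)) (e : B)
    (a b : A) : slice τ e (a * b) = slice τ e (b * a) := by
  have h1 : (tmul (a * b) e : MinTensor A B) = tmul a 1 * tmul b e := by
    rw [tmul_mul_tmul, one_mul]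
  have h2 : (tmul (b * a) e : MinTensor A B) = tmul b e * tmul a 1 := by
    rw [tmul_mul_tmul, mul_one]
  rw [slice_apply, slice_apply, h1, h2, hτ.2.2]

lemma slice_star_mul_self_nonneg {τ : WeakDual ℂ (MinTensor A B)}
    (hτ : τ ∈ traceSpace (MinTensor A B)) (y : B) (a : A) :
    0 ≤ slice τ (star y * y) (star a * a) := by
  rw [slice_apply, ← tmul_mul_tmul, ← star_tmul]
  exact hτ.1 _

lemma slice_add (τ : WeakDual ℂ (MinTensor A B)) (e e' : B) (a : A) :
    slice τ (e + e') a = slice τ e a + slice τ e' a := by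
  rw [slice_apply, tmul_add, map_add, slice_apply, slice_apply]

/-- Slicing a trace of `A ⊗ B` by a positive element of `B` gives a positive multiple of a trace
of `A`. The summand `1` keeps the total mass at least `1`, so that the slice can be normalised. -/
lemma exists_trace_slice {τ : WeakDual ℂ (MinTensor A B)} (hτ : τ ∈ traceSpace (MinTensor A B))
    (y : B) : ∃ σ ∈ traceSpace A, ∀ a : A,
      τ (tmul a (star y * y + 1)) = τ (tmul 1 (star y * y + 1)) * σ a := by
  have hpos : ∀ a : A, 0 ≤ slice τ (star y * y + 1) (star a * a) := fun a => by
    rw [slice_add]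
    exact add_nonneg (slice_star_mul_self_nonneg hτ y a)
      (by simpa using slice_star_mul_self_nonneg hτ 1 a)
  have hmass : 1 ≤ slice τ (star y * y + 1) 1 := by
    rw [slice_add, slice_apply τ 1, one_tmul_one, hτ.2.1]
    exact le_add_of_nonneg_left (by simpa using slice_star_mul_self_nonneg hτ y 1)
  have hm0 : slice τ (star y * y + 1) 1 ≠ 0 := (zero_lt_one.trans_le hmass).ne'
  have hinv : 0 ≤ (slice τ (star y * y + 1) 1)⁻¹ := inv_nonneg.2 (zero_le_one.trans hmass)
  simp only [← slice_apply τ (star y * y + 1)]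
  have hsm : ∀ a, ((slice τ (star y * y + 1) 1)⁻¹ • slice τ (star y * y + 1)) a =
      (slice τ (star y * y + 1) 1)⁻¹ * slice τ (star y * y + 1) a := fun _ => rfl
  refine ⟨(slice τ (star y * y + 1) 1)⁻¹ • slice τ (star y * y + 1),
    ⟨fun a => ?_, ?_, fun a b => ?_⟩, fun a => ?_⟩
  · rw [hsm]
    exact mul_nonneg hinv (hpos a)
  · rw [hsm, inv_mul_cancel₀ hm0]
  · rw [hsm, hsm, slice_mul_comm hτ]
  · rw [hsm, mul_inv_cancel_left₀ hm0]

/-- An element of `A^U` that all limit traces scale against `d ∈ A` by a factor `c` is, inside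
`(A ⊗ B)^U`, scaled against `d ⊗ e` by the same factor for every `e ∈ B`. -/
lemma limitTrace_map_inclLeft_mul_const_tmul {x : TracialUltrapower U A} {d : A} {c : ℂ}
    (hx : ∀ σ ∈ limitTraces U A, σ (x * const U d) = c * σ (const U d))
    {τ : TracialUltrapower U (MinTensor A B) →ₗ[ℂ] ℂ} (hτ : τ ∈ limitTraces U (MinTensor A B))
    (e : B) :
    τ (TracialUltrapower.map U inclLeft x * const U (tmul d e)) = c * τ (const U (tmul d e)) := by
  obtain ⟨q, rfl⟩ := mk_surjective U x
  have hpos : ∀ y : B, τ (TracialUltrapower.map U inclLeft (mk U q) * const U (tmul d (star y * y + 1))) =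
      c * τ (const U (tmul d (star y * y + 1))) := fun y => by
    obtain ⟨t, ht, h⟩ := hτ
    choose s hs hst using fun n => exists_trace_slice (ht n) y
    obtain ⟨σ, hσ, hσs⟩ := exists_limitTrace U s hs
    -- `tₙ(a ⊗ (y⋆y + 1)) = tₙ(1 ⊗ (y⋆y + 1)) sₙ(a)`, and the masses converge along `U` as well
    have key : ∀ a : ℕ →ᵇ A, ∀ z : ℕ →ᵇ MinTensor A B,
        (∀ n, z n = tmul (a n) (star y * y + 1)) →
        τ (mk U z) = τ (const U (tmul 1 (star y * y + 1))) * σ (mk U a) := fun a z hz => by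
      refine tendsto_nhds_unique (h z) (((h _).mul (hσs a)).congr fun n => ?_)
      rw [hz, hst, BoundedContinuousFunction.const_apply]
    have h1 := key (q * .const ℕ d) (mapSeq inclLeft q * .const ℕ (tmul d (star y * y + 1)))
      fun n => by
        change inclLeft (q n) * tmul d (star y * y + 1) = tmul (q n * d) (star y * y + 1)
        rw [inclLeft_apply, tmul_mul_tmul, one_mul]
    have h2 := key (.const ℕ d) (.const ℕ (tmul d (star y * y + 1))) fun n => rfl
    rw [map_mul (mk U), map_mul (mk U)] at h1
    rw [map_mk, const, h1, h2]
    have h3 := hx σ hσ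
    rw [const] at h3
    rw [h3, mul_left_comm]
  -- the scaling identity is linear in the right-hand tensor factor, and `B` is spanned by the
  -- elements `y⋆y = (y⋆y + 1) - 1`
  let P : B → Prop := fun e =>
    τ (TracialUltrapower.map U inclLeft (mk U q) * const U (tmul d e)) = c * τ (const U (tmul d e))
  have Padd : ∀ e e', P e → P e' → P (e + e') := fun e e' h h' => by
    simp only [P] at h h' ⊢
    rw [tmul_add, const_add, mul_add, map_add, h, h', map_add, mul_add]
  have Psmul : ∀ (r : ℂ) e, P e → P (r • e) := fun r e h => by
    simp only [P] at h ⊢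
    rw [tmul_smul, const_smul, mul_smul_comm, map_smul, h, map_smul, smul_eq_mul, smul_eq_mul,
      mul_left_comm]
  have P1 : P 1 := by simpa [P] using hpos 0
  have hmem : e ∈ Submodule.span ℂ {b : B | 0 ≤ b} := by
    rw [CStarAlgebra.span_nonneg]
    trivial
  change P e
  induction hmem using Submodule.span_induction with
  | mem e he =>
    obtain ⟨y, rfl⟩ := CStarAlgebra.nonneg_iff_eq_star_mul_self.mp he
    have h := Padd _ _ (hpos y) (Psmul (-1) 1 P1)
    simpa using h
  | zero => simpa using Psmul 0 1 P1
  | add e e' _ _ h h' => exact Padd e e' h h'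
  | smul r e _ h => exact Psmul r e h

/-- An element of `A^U ∩ A'` commutes with `A ⊗ B` inside `(A ⊗ B)^U`: its entries `q ⊗ 1` commute
exactly with `1 ⊗ b`, and the elements commuting with it form a closed subspace. -/
lemma commute_const_map_inclLeft {x : TracialUltrapower U A} (hx : ∀ a, Commute (const U a) x)
    (z : MinTensor A B) : Commute (const U z) (TracialUltrapower.map U inclLeft x) := by
  induction z using induction_on with
  | hc => exact isClosed_setOf_commute_const _
  | h0 => exact const_zero (U := U) (A := MinTensor A B) ▸ Commute.zero_left _
  | ha y z hy hz => exact const_add y z ▸ hy.add_left hz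
  | hs c z hz => exact const_smul c z ▸ hz.smul_left c
  | ht a b =>
    have hab : const U (tmul a b : MinTensor A B) =
        map U inclLeft (const U a) * const U (tmul 1 b) := by
      rw [TracialUltrapower.map_const, ← const_mul, inclLeft_apply, tmul_mul_tmul, mul_one, one_mul]
    rw [hab]
    refine Commute.mul_left ((hx a).map (TracialUltrapower.map U inclLeft)) ?_
    obtain ⟨q, rfl⟩ := mk_surjective U x
    rw [map_mk, commute_const_mk_iff]
    refine tendsto_const_nhds.congr fun n => ?_
    rw [mapSeq_apply, inclLeft_apply, tmul_mul_tmul, tmul_mul_tmul, one_mul, mul_one, one_mul,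
      mul_one, sub_self, uniformTwoNorm_zero]

end MinTensor

end

open TracialUltrapower MinTensor in
theorem proposition5p7 (U : Ultrafilter ℕ) (hU : (U : Filter ℕ) ≤ Filter.cofinite)
    {A B : Type*}
    [CStarAlgebra A] [PartialOrder A] [StarOrderedRing A]
    [CStarAlgebra B] [PartialOrder B] [StarOrderedRing B]
    [TopologicalSpace.SeparableSpace A] [TopologicalSpace.SeparableSpace B]
    (hTA : (traceSpace A).Nonempty) (hTB : (traceSpace B).Nonempty)
    (DA : StarSubalgebra ℂ A) (hDA : IsClosed (DA : Set A))
    (DB : StarSubalgebra ℂ B) (hDB : IsClosed (DB : Set B))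
    (hΓ : HasUniformPropertyGamma U DA) :
    HasUniformPropertyGamma U (MinTensor.subalgebra DA DB) where
  isClosed := isClosed_cstarGenerated _
  separable := separableSpace
  nonempty_traceSpace := nonempty_traceSpace hTA hTB
  isCompact_traceSpace := traceSpace.isCompact _
  one_mem := ⟨1, fun _ => one_mem _, map_one _⟩
  exists_partition k hk := by
    obtain ⟨q, hproj, hmem, hsum, htr⟩ := hΓ.exists_partition k hk
    refine ⟨fun i => TracialUltrapower.map U inclLeft (q i), fun i => isStarProjection_map _ (hproj i),
      fun i => ⟨?_, ?_⟩, ?_, fun τ hτ x hx i => ?_⟩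
    · obtain ⟨d, hd, hdq⟩ := (hmem i).1
      exact ⟨mapSeq inclLeft d, fun n => tmul_mem_subalgebra (hd n) (one_mem DB), by
        rw [← map_mk, hdq]⟩
    · rintro _ ⟨z, rfl⟩
      exact commute_const_map_inclLeft (fun a => (hmem i).2 _ ⟨a, rfl⟩) z
    · rw [← map_sum, hsum, map_one]
    · have hcont := continuous_limitTrace_mul_const hτ
      refine subalgebra_induction (p := fun x => τ (TracialUltrapower.map U inclLeft (q i) * const U x) =
        1 / (k : ℂ) * τ (const U x)) ?_ ?_ (fun d hd e _ => ?_) (fun x y h h' => ?_)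
        (fun r x h => ?_) hx
      · refine isClosed_eq (hcont _) (continuous_const.mul ?_)
        simpa using hcont 1
      · simp [const_zero]
      · exact limitTrace_map_inclLeft_mul_const_tmul (fun σ hσ => htr σ hσ d hd i) hτ e
      · rw [const_add, mul_add, map_add, h, h', map_add, mul_add]
      · rw [const_smul, mul_smul_comm, map_smul, h, map_smul, smul_eq_mul, smul_eq_mul, mul_left_comm]
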